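/- All graphs are finite and simple. For a graph $G$ of order $N$ let $\lambda_1(G)\ge\cdots\ge\lambda_N(G)$ be the eigenvalues of its adjacency matrix, listed with multiplicity. For two graphs $G,H$ of the same order $N$ put $\sigma(G,H)=\sum_{i=1}^{N}|\lambda_i(G)-\lambda_i(H)|$, and define the ($\ell^1$-)cospectrality of $G$ by $$\mathrm{cs}(G)=\min\{\sigma(G,H) : H \text{ a graph of the same order as } G,\ H\not\cong G\}.$$ Let $K_{p,q}$ denote the complete bipartite graph with parts of sizes $p$ and $q$. Theorem. For every integer $n\ge 2$, $$\mathrm{cs}(K_{n,n})=2\bigl(n-\sqrt{n^2-1}\bigr).$$ Moreover, for every graph $H$ of order $2n$, $\mathrm{cs}(K_{n,n})=\sigma(K_{n,n},H)$ if and only if $H\cong K_{n-1,n+1}$. -/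

import Mathlib

namespace SimpleGraph

variable {V : Type*} [Fintype V] {W : Type*} [Fintype W]

open Classical in
/-- The eigenvalues `λ₁ ≥ λ₂ ≥ ⋯` of the (real) adjacency matrix of a finite graph, listed with
multiplicity in decreasing order and indexed from `0`. -/
noncomputable def adjEigenvalue (G : SimpleGraph V) : Fin (Fintype.card V) → ℝ :=
  (G.isHermitian_adjMatrix (R := ℝ)).eigenvalues₀

/-- The `ℓ¹` distance `σ(G, H) = ∑ i, |λ_i(G) - λ_i(H)|` between the ordered spectra of two graphs
of the same order. -/
noncomputable def spectralDist (G : SimpleGraph V) (H : SimpleGraph W)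
    (h : Fintype.card V = Fintype.card W) : ℝ :=
  ∑ i : Fin (Fintype.card V), |G.adjEigenvalue i - H.adjEigenvalue (Fin.cast h i)|

/-- The values `σ(G, H)`, where `H` runs over the graphs of the same order as `G` that are not
isomorphic to `G`. Every graph of that order has a copy on the vertex set of `G`, so `H` is taken
on this vertex set. -/
def spectralDistSet (G : SimpleGraph V) : Set ℝ :=
  {d | ∃ H : SimpleGraph V, ¬ Nonempty (G ≃g H) ∧ d = G.spectralDist H rfl}

/-- The `ℓ¹`-cospectrality `cs(G) = min {σ(G, H) : H not isomorphic to G}`. The set is finite, so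
for graphs with at least two vertices this infimum is a minimum, see `isLeast_cospectrality`. -/
noncomputable def cospectrality (G : SimpleGraph V) : ℝ :=
  sInf G.spectralDistSet

theorem isLeast_cospectrality [Nontrivial V] (G : SimpleGraph V) :
    IsLeast G.spectralDistSet G.cospectrality := by
  have hfin : G.spectralDistSet.Finite := by
    refine (Set.finite_range fun H : SimpleGraph V => G.spectralDist H rfl).subset ?_
    rintro d ⟨H, -, rfl⟩
    exact ⟨H, rfl⟩
  have hne : G.spectralDistSet.Nonempty := by
    by_contra hcon
    have key : ∀ H : SimpleGraph V, Nonempty (G ≃g H) := by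
      intro H
      by_contra hH
      exact hcon ⟨_, H, hH, rfl⟩
    obtain ⟨e⟩ := key ⊥
    obtain ⟨f⟩ := key ⊤
    obtain ⟨x, y, hxy⟩ := exists_pair_ne V
    have h1 : G.Adj (f.symm x) (f.symm y) := f.symm.map_adj_iff.2 hxy
    exact e.map_adj_iff.2 h1
  exact ⟨hne.csInf_mem hfin, fun d hd => csInf_le hfin.bddBelow hd⟩

end SimpleGraph

/-!
The spectrum of `K_{n,n}` is `n, 0, …, 0, -n`, and that of `K_{n-1,n+1}` is `r, 0, …, 0, -r` with
`r = √(n² - 1)`, so they are at distance `2 (n - r)`. Everything rests on the converse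
`iso_of_sum_abs_sub_le`: a graph `H` of order `2n` whose spectrum is within this distance of that of
`K_{n,n}` is one of the two graphs.

Since the eigenvalues of `H` sum to zero, the deviation at one end of the spectrum has to be
compensated elsewhere, so the smallest eigenvalue `-b` absorbs at most half of the distance, and
`b ≥ r` (`least_bounds_of_sum_abs_sub_le`). Splitting the vertices by the sign of an eigenvector for
`-b` gives disjoint sets `P` and `Q` with at least `b²` edges between them
(`exists_sq_le_card_interedges`). Hence there are at least `n² - 1` such edges, and at most
`|P| |Q| ≤ n²`. The sum of the squares of the eigenvalues, which is twice the number of edges, is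
close enough to `2n²` to exclude any further edges. If there are `n²` edges between `P` and `Q`,
then `H` is `K_{n,n}`. If there are `n² - 1`, then equality holds in the bound `b² ≤ e(P, Q)`, which
forces all pairs between `P` and `Q` to be adjacent; so `|P| |Q| = n² - 1`, the parts have sizes
`n - 1` and `n + 1`, and `H` is `K_{n-1,n+1}`.
-/

open Finset Matrix

namespace SimpleGraph

/-! ### Eigenvalues of the adjacency matrix -/

section Spectrum

variable {V : Type*} [Fintype V]

theorem antitone_adjEigenvalue (G : SimpleGraph V) : Antitone G.adjEigenvalue := by
  classical
  exact IsHermitian.eigenvalues₀_antitone _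

theorem sum_adjEigenvalue (G : SimpleGraph V) : ∑ i, G.adjEigenvalue i = 0 := by
  classical
  have h := (G.isHermitian_adjMatrix (R := ℝ)).trace_eq_sum_eigenvalues
  rw [trace_adjMatrix] at h
  rw [← Equiv.sum_comp (Fintype.equivOfCardEq (Fintype.card_fin _)).symm]
  exact h.symm

open Classical in
theorem sum_adjEigenvalue_sq (G : SimpleGraph V) :
    ∑ i, G.adjEigenvalue i ^ 2 = 2 * (#G.edgeFinset : ℝ) := by
  have hA := G.isHermitian_adjMatrix (R := ℝ)
  have h1 : (G.adjMatrix ℝ * G.adjMatrix ℝ).trace = ∑ i, hA.eigenvalues i ^ 2 := by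
    conv_lhs => rw [hA.spectral_theorem, ← map_mul, Unitary.conjStarAlgAut_apply, trace_mul_comm,
      ← mul_assoc, diagonal_mul_diagonal]
    simp [trace_diagonal, sq]
  have h2 : (G.adjMatrix ℝ * G.adjMatrix ℝ).trace = 2 * (#G.edgeFinset : ℝ) := by
    simp only [Matrix.trace, diag_apply, adjMatrix_mul_self_apply_self]
    exact_mod_cast G.sum_degrees_eq_twice_card_edges
  rw [← h2, h1, ← Equiv.sum_comp (Fintype.equivOfCardEq (Fintype.card_fin _)).symm]
  rfl

open Classical in
theorem exists_unit_eigenvector (G : SimpleGraph V) (i : Fin (Fintype.card V)) :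
    ∃ z : V → ℝ, G.adjMatrix ℝ *ᵥ z = G.adjEigenvalue i • z ∧ ∑ v, z v ^ 2 = 1 := by
  have hA := G.isHermitian_adjMatrix (R := ℝ)
  let e : Fin (Fintype.card V) ≃ V := Fintype.equivOfCardEq (Fintype.card_fin _)
  refine ⟨hA.eigenvectorBasis (e i), ?_, ?_⟩
  · rw [hA.mulVec_eigenvectorBasis]
    congr 1
    simp [IsHermitian.eigenvalues, adjEigenvalue, e]
  · have h := hA.eigenvectorBasis.orthonormal.1 (e i)
    rw [EuclideanSpace.norm_eq, Real.sqrt_eq_one] at h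
    simpa using h

open Classical in
theorem exists_adjEigenvalue_eq (G : SimpleGraph V) {z : V → ℝ} {μ : ℝ} (hz : z ≠ 0)
    (h : G.adjMatrix ℝ *ᵥ z = μ • z) : ∃ i, G.adjEigenvalue i = μ := by
  have hA := G.isHermitian_adjMatrix (R := ℝ)
  have hμ : μ ∈ spectrum ℝ (G.adjMatrix ℝ) := by
    rw [← Matrix.spectrum_toLin', ← Module.End.hasEigenvalue_iff_mem_spectrum]
    exact Module.End.hasEigenvalue_of_hasEigenvector (x := z)
      ⟨Module.End.mem_eigenspace_iff.2 (by simpa using h), hz⟩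
  rw [hA.spectrum_real_eq_range_eigenvalues] at hμ
  obtain ⟨v, hv⟩ := hμ
  exact ⟨_, hv⟩

end Spectrum

/-! ### Spectra supported at the two ends -/

/-- The sequence `s, 0, …, 0, -s` of length `N`, meaningful for `2 ≤ N`. -/
def symmSpectrum (s : ℝ) {N : ℕ} (i : Fin N) : ℝ :=
  if i.val = 0 then s else if i.val + 1 = N then -s else 0

/-- The indices of `Fin N` other than the first and the last one. -/
def midIndices (N : ℕ) : Finset (Fin N) := {i | i.val ≠ 0 ∧ i.val + 1 ≠ N}

theorem sum_eq_first_add_last_add_mid {N : ℕ} (hN : 2 ≤ N) (f : Fin N → ℝ) :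
    ∑ i, f i = f ⟨0, by omega⟩ + f ⟨N - 1, by omega⟩ + ∑ i ∈ midIndices N, f i := by
  have h : (univ : Finset (Fin N)) =
      insert ⟨0, by omega⟩ (insert ⟨N - 1, by omega⟩ (midIndices N)) := by
    ext i
    simp only [midIndices, mem_univ, mem_insert, mem_filter, true_and, true_iff, Fin.ext_iff]
    omega
  rw [h, sum_insert, sum_insert, add_assoc]
  · simp [midIndices]; omega
  · simp [midIndices]; omega

@[simp] theorem symmSpectrum_first (s : ℝ) {N : ℕ} (hN : 0 < N) :
    symmSpectrum s (⟨0, hN⟩ : Fin N) = s := by simp [symmSpectrum]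

theorem symmSpectrum_last (s : ℝ) {N : ℕ} (hN : 2 ≤ N) :
    symmSpectrum s (⟨N - 1, by omega⟩ : Fin N) = -s := by
  rw [symmSpectrum, if_neg (by dsimp only; omega), if_pos (by dsimp only; omega)]

theorem symmSpectrum_mid (s : ℝ) {N : ℕ} {i : Fin N} (hi : i ∈ midIndices N) :
    symmSpectrum s i = 0 := by
  simp only [midIndices, mem_filter, mem_univ, true_and] at hi
  rw [symmSpectrum, if_neg hi.1, if_neg hi.2]

theorem sum_abs_symmSpectrum_sub {N : ℕ} (hN : 2 ≤ N) (s t : ℝ) :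
    ∑ i : Fin N, |symmSpectrum s i - symmSpectrum t i| = 2 * |s - t| := by
  rw [sum_eq_first_add_last_add_mid hN, sum_eq_zero (s := midIndices N), symmSpectrum_last s hN,
    symmSpectrum_last t hN, symmSpectrum_first, symmSpectrum_first, neg_sub_neg, abs_sub_comm t s]
  · ring
  · intro i hi
    simp [symmSpectrum_mid _ hi]

/-- A decreasing sequence containing `s` and `-s` whose squares sum to `2 * s ^ 2` has no room
for other nonzero terms. -/
theorem eq_symmSpectrum {N : ℕ} (hN : 2 ≤ N) {l : Fin N → ℝ} (hl : Antitone l) {s : ℝ} (hs : 0 ≤ s)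
    (hpos : ∃ i, l i = s) (hneg : ∃ i, l i = -s) (hsq : ∑ i, l i ^ 2 = 2 * s ^ 2) (i : Fin N) :
    l i = symmSpectrum s i := by
  obtain ⟨j, hj⟩ := hpos
  obtain ⟨k, hk⟩ := hneg
  have h0 : s ≤ l ⟨0, by omega⟩ := hj ▸ hl (Fin.mk_le_of_le_val (Nat.zero_le _))
  have h1 : l ⟨N - 1, by omega⟩ ≤ -s := hk ▸ hl (Fin.le_def.2 (by dsimp only; omega))
  rw [sum_eq_first_add_last_add_mid hN] at hsq
  have hm : 0 ≤ ∑ i ∈ midIndices N, l i ^ 2 := sum_nonneg fun i _ => sq_nonneg _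
  have hm0 : ∑ i ∈ midIndices N, l i ^ 2 = 0 := by nlinarith
  rw [sum_eq_zero_iff_of_nonneg fun i _ => sq_nonneg _] at hm0
  rw [symmSpectrum]
  split_ifs with hi hi'
  · rw [show i = ⟨0, by omega⟩ from Fin.ext hi]
    nlinarith
  · rw [show i = ⟨N - 1, by omega⟩ from Fin.ext (by dsimp only; omega)]
    nlinarith
  · simpa using hm0 i (by simp [midIndices, hi, hi'])

/-! ### Complete bipartite graphs -/

section Bipartite

variable {W : Type*} [Fintype W] {H : SimpleGraph W} {p q : ℕ}

open Classical in
theorem card_edgeFinset_completeBipartite (f : H ≃g completeBipartiteGraph (Fin p) (Fin q)) :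
    #H.edgeFinset = p * q := by
  rw [f.card_edgeFinset_eq]
  have := (completeBipartiteGraph (Fin p) (Fin q)).sum_degrees_eq_twice_card_edges
  have h2 : ∀ x : Fin p ⊕ Fin q, (completeBipartiteGraph (Fin p) (Fin q)).degree x =
      Sum.elim (fun _ => q) (fun _ => p) x := by
    rintro (x | x)
    · rw [← card_neighborFinset_eq_degree, neighborFinset_eq_filter, Finset.card_filter]
      simp [-sum_boole]
    · rw [← card_neighborFinset_eq_degree, neighborFinset_eq_filter, Finset.card_filter]
      simp [-sum_boole]
  simp [h2] at this
  linarith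

open Classical in
/-- Both square roots of `p * q` are eigenvalues of `K_{p,q}`: the vector equal to `q` on the first
part and to `s` on the second one is an eigenvector. -/
theorem exists_adjEigenvalue_completeBipartite (f : H ≃g completeBipartiteGraph (Fin p) (Fin q))
    (hp : 0 < p) {s : ℝ} (hs : s ^ 2 = p * q) (hs0 : s ≠ 0) : ∃ i, H.adjEigenvalue i = s := by
  refine H.exists_adjEigenvalue_eq (z := fun w => Sum.elim (fun _ => (q : ℝ)) (fun _ => s) (f w))
    ?_ ?_
  · intro h
    have hq : (q : ℝ) ≠ 0 := by
      rintro hq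
      exact hs0 (by simpa [hq] using hs)
    have := congrFun h (f.symm (Sum.inl ⟨0, hp⟩))
    simp only [RelIso.apply_symm_apply, Sum.elim_inl, Pi.zero_apply] at this
    exact hq this
  · ext w
    obtain ⟨x, rfl⟩ := f.symm.surjective w
    have h : ∀ u, H.adjMatrix ℝ (f.symm x) u =
        (completeBipartiteGraph (Fin p) (Fin q)).adjMatrix ℝ x (f u) := by
      intro u
      simp only [adjMatrix_apply, ← f.map_adj_iff, RelIso.apply_symm_apply]
    simp only [mulVec, dotProduct, h, Pi.smul_apply, RelIso.apply_symm_apply, smul_eq_mul]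
    refine (Fintype.sum_equiv f.toEquiv _ (fun u =>
      (completeBipartiteGraph (Fin p) (Fin q)).adjMatrix ℝ x u *
        Sum.elim (fun _ => (q : ℝ)) (fun _ => s) u) fun _ => rfl).trans ?_
    rcases x with x | x
    · simp [adjMatrix_apply, mul_comm]
    · simp [adjMatrix_apply, ← sq, hs]

/-- The spectrum of `K_{p,q}` is `√(pq), 0, …, 0, -√(pq)`. -/
theorem adjEigenvalue_completeBipartite (f : H ≃g completeBipartiteGraph (Fin p) (Fin q))
    (hp : 0 < p) (hq : 0 < q) (i : Fin (Fintype.card W)) :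
    H.adjEigenvalue i = symmSpectrum (Real.sqrt (p * q)) i := by
  classical
  have hpq : (0 : ℝ) < p * q := by positivity
  have hsq : Real.sqrt (p * q) ^ 2 = p * q := Real.sq_sqrt hpq.le
  have hs : 0 < Real.sqrt (p * q) := Real.sqrt_pos.2 hpq
  have hN : Fintype.card W = p + q := by simpa using Fintype.card_congr f.toEquiv
  refine eq_symmSpectrum (by omega) H.antitone_adjEigenvalue hs.le
    (exists_adjEigenvalue_completeBipartite f hp hsq hs.ne')
    (exists_adjEigenvalue_completeBipartite f hp (by rw [neg_sq, hsq]) (neg_ne_zero.2 hs.ne')) ?_ i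
  rw [sum_adjEigenvalue_sq, card_edgeFinset_completeBipartite f, hsq]
  push_cast
  ring

theorem nonempty_iso_completeBipartite (P : Finset W) (hP : #P = p) (hW : Fintype.card W = p + q)
    (h : ∀ u v, H.Adj u v ↔ ¬ (u ∈ P ↔ v ∈ P)) :
    Nonempty (H ≃g completeBipartiteGraph (Fin p) (Fin q)) := by
  classical
  have e₁ : {x // x ∈ P} ≃ Fin p := Fintype.equivFinOfCardEq (by simpa using hP)
  have e₂ : {x // x ∉ P} ≃ Fin q := Fintype.equivFinOfCardEq (by
    rw [Fintype.card_subtype_compl, Fintype.card_coe]; omega)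
  refine ⟨RelIso.symm ⟨(Equiv.sumCongr e₁.symm e₂.symm).trans (Equiv.sumCompl (· ∈ P)), ?_⟩⟩
  rintro (a | a) (b | b)
  · simp [h, (e₁.symm a).2, (e₁.symm b).2]
  · simp [h, (e₁.symm a).2, (e₂.symm b).2]
  · simp [h, (e₂.symm a).2, (e₁.symm b).2]
  · simp [h, (e₂.symm a).2, (e₂.symm b).2]

end Bipartite

/-! ### Eigenvectors of negative eigenvalues and cuts -/

section LeastEigenvalue

variable {V : Type*} [Fintype V] (G : SimpleGraph V)

open Classical in
/-- If `-b < 0` is an eigenvalue of the adjacency matrix, split the vertices by the sign of an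
eigenvector into `P` and `Q`. Only the edges between `P` and `Q` contribute negatively to the
quadratic form, and Cauchy-Schwarz bounds `b ^ 2` by their number. In the case of equality the
products of the entries are constant on these edges and vanish on non-adjacent pairs; they never
vanish on `P × Q`, so that all pairs are adjacent. Vertices where the eigenvector is zero lie
in neither set. -/
theorem exists_sq_le_card_interedges {z : V → ℝ} {b : ℝ} (hb : 0 < b)
    (hz : G.adjMatrix ℝ *ᵥ z = (-b) • z) (hz1 : ∑ v, z v ^ 2 = 1) :
    ∃ P Q : Finset V, Disjoint P Q ∧ b ^ 2 ≤ #(G.interedges P Q) ∧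
      (b ^ 2 = #(G.interedges P Q) → ∀ u ∈ P, ∀ v ∈ Q, G.Adj u v) := by
  let P : Finset V := {v | 0 < z v}
  let Q : Finset V := {v | z v < 0}
  let B : V × V → ℝ := fun x => if x ∈ G.interedges P Q then 1 else 0
  let w : V × V → ℝ := fun x => max (z x.1) 0 * max (-z x.2) 0
  have hB : ∀ u v, B (u, v) = if 0 < z u ∧ z v < 0 ∧ G.Adj u v then 1 else 0 := fun u v => by
    simp [B, P, Q, mem_interedges_iff]
  have hBsum : ∑ x, B x = #(G.interedges P Q) := by simp [B]
  have hBsq : ∀ x, B x ^ 2 = B x := fun x => by simp only [B]; split_ifs <;> simp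
  have hquad : ∑ u, ∑ v, G.adjMatrix ℝ u v * (z u * z v) = -b := by
    calc ∑ u, ∑ v, G.adjMatrix ℝ u v * (z u * z v) = ∑ u, z u * (G.adjMatrix ℝ *ᵥ z) u := by
          refine sum_congr rfl fun u _ => ?_
          rw [mulVec, dotProduct, mul_sum]
          exact sum_congr rfl fun v _ => by ring
      _ = -b * ∑ v, z v ^ 2 := by
          rw [hz, mul_sum]
          exact sum_congr rfl fun u _ => by rw [Pi.smul_apply, smul_eq_mul]; ring
      _ = -b := by rw [hz1, mul_one]
  have hterm : ∀ u v, -(G.adjMatrix ℝ u v * (z u * z v)) ≤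
      B (u, v) * w (u, v) + B (v, u) * w (v, u) := by
    intro u v
    rw [hB, hB, adjMatrix_apply, G.adj_comm v u]
    by_cases huv : G.Adj u v
    · simp only [huv, and_true, if_true, one_mul, w]
      rcases lt_trichotomy (z u) 0 with hu | hu | hu <;>
      rcases lt_trichotomy (z v) 0 with hv | hv | hv <;>
      simp [hu, hv, hu.le, hv.le, hu.not_gt, hv.not_gt] <;> nlinarith
    · simp [huv]
  have hX : b ≤ 2 * ∑ x, B x * w x := by
    have h1 := sum_le_sum fun u (_ : u ∈ univ) => sum_le_sum fun v (_ : v ∈ univ) => hterm u v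
    simp only [sum_neg_distrib, hquad, sum_add_distrib] at h1
    rw [sum_comm (f := fun u v => B (v, u) * w (v, u))] at h1
    rw [Fintype.sum_prod_type]
    linarith
  -- The squared weights of the two signs add up to `1`, so their product is at most `1 / 4`.
  have hw2 : ∑ x, w x ^ 2 ≤ 1 / 4 := by
    have h1 : ∑ x, w x ^ 2 = (∑ u, max (z u) 0 ^ 2) * ∑ v, max (-z v) 0 ^ 2 := by
      rw [sum_mul_sum, Fintype.sum_prod_type]
      simp only [w, mul_pow]
    have h2 : ∑ u, max (z u) 0 ^ 2 + ∑ v, max (-z v) 0 ^ 2 = 1 := by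
      rw [← hz1, ← sum_add_distrib]
      refine sum_congr rfl fun v _ => ?_
      rcases le_total (z v) 0 with h | h <;> simp [h]
    rw [h1]
    nlinarith [sq_nonneg (∑ u, max (z u) 0 ^ 2 - ∑ v, max (-z v) 0 ^ 2)]
  have he : (0 : ℝ) < #(G.interedges P Q) := by
    rw [Nat.cast_pos, Finset.card_pos]
    by_contra hne
    rw [not_nonempty_iff_eq_empty] at hne
    simp only [B, hne, notMem_empty, if_false, zero_mul, sum_const_zero, mul_zero] at hX
    linarith
  set e : ℝ := (#(G.interedges P Q) : ℝ) with he_def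
  -- The value of `t` for which `w = t • B` in the extremal case.
  set t : ℝ := b / (2 * e) with ht
  have hte : t * e = b / 2 := by rw [ht]; field_simp
  have hsum : ∑ x, (w x - t * B x) ^ 2 ≤ 1 / 4 - t * b / 2 := by
    have h1 : ∑ x, (w x - t * B x) ^ 2 =
        ∑ x, w x ^ 2 - 2 * t * ∑ x, B x * w x + t ^ 2 * ∑ x, B x := by
      rw [mul_sum, mul_sum, ← sum_sub_distrib, ← sum_add_distrib]
      refine sum_congr rfl fun x _ => ?_
      linear_combination t ^ 2 * hBsq x
    have ht0 : 0 < t := by positivity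
    rw [h1, hBsum]
    have h2 : t ^ 2 * e = t * b / 2 := by linear_combination t * hte
    nlinarith
  have hnn : 0 ≤ ∑ x, (w x - t * B x) ^ 2 := sum_nonneg fun x _ => sq_nonneg _
  have htb : t * b = b ^ 2 / (2 * e) := by rw [ht]; ring
  refine ⟨P, Q, ?_, ?_, ?_⟩
  · rw [Finset.disjoint_left]
    intro v hv hv'
    simp only [P, Q, mem_filter, mem_univ, true_and] at hv hv'
    linarith
  · have h1 : b ^ 2 / (2 * e) ≤ 1 / 2 := by linarith
    rw [div_le_iff₀ (by positivity)] at h1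
    linarith
  · intro heq u hu v hv
    have h1 : ∑ x, (w x - t * B x) ^ 2 = 0 := by
      refine le_antisymm (hsum.trans_eq ?_) hnn
      rw [htb, heq, ← he_def]
      field_simp
      norm_num
    rw [sum_eq_zero_iff_of_nonneg fun x _ => sq_nonneg _] at h1
    have h2 := h1 (u, v) (mem_univ _)
    rw [sq_eq_zero_iff] at h2
    simp only [P, Q, mem_filter, mem_univ, true_and] at hu hv
    by_contra hadj
    have h3 : 0 < w (u, v) := mul_pos (lt_max_of_lt_left hu) (lt_max_of_lt_left (by linarith))
    rw [hB, if_neg (by tauto)] at h2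
    linarith

open Classical in
/-- The edges between two disjoint sets `P` and `Q` are among the edges of `G`; if they are all of
them, every edge runs between `P` and `Q`. -/
theorem card_interedges_le_card_edgeFinset {P Q : Finset V} (hPQ : Disjoint P Q) :
    #(G.interedges P Q) ≤ #G.edgeFinset ∧
      (#G.edgeFinset = #(G.interedges P Q) →
        ∀ u v, G.Adj u v → (u ∈ P ∧ v ∈ Q) ∨ (u ∈ Q ∧ v ∈ P)) := by
  have hcard : #{x : V × V | G.Adj x.1 x.2} = 2 * #G.edgeFinset := by
    rw [← G.sum_degrees_eq_twice_card_edges, card_filter, Fintype.sum_prod_type]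
    refine sum_congr rfl fun v _ => ?_
    rw [← card_neighborFinset_eq_degree, neighborFinset_eq_filter, card_filter]
  have hdisj : Disjoint (G.interedges P Q) (G.interedges Q P) := by
    rw [Finset.disjoint_left]
    intro x hx hx'
    rw [mem_interedges_iff] at hx hx'
    exact Finset.disjoint_left.1 hPQ hx.1 hx'.1
  have hu : #(G.interedges P Q ∪ G.interedges Q P) = 2 * #(G.interedges P Q) := by
    rw [card_union_of_disjoint hdisj, two_mul, Nat.add_left_cancel_iff]
    have : Std.Symm G.Adj := ⟨fun _ _ h => h.symm⟩
    exact Rel.card_interedges_comm Q P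
  have hsub : G.interedges P Q ∪ G.interedges Q P ⊆ ({x : V × V | G.Adj x.1 x.2} : Finset _) := by
    intro x hx
    simp only [mem_union, mem_interedges_iff] at hx
    simp only [mem_filter, mem_univ, true_and]
    tauto
  have hle := card_le_card hsub
  refine ⟨by omega, fun h u v huv => ?_⟩
  have := eq_of_subset_of_card_le hsub (by rw [hu, hcard, h])
  have hm : (u, v) ∈ G.interedges P Q ∪ G.interedges Q P := by rw [this]; simpa using huv
  simp only [mem_union, mem_interedges_iff] at hm
  tauto

open Classical in
/-- A graph is complete bipartite with parts `P` and `Q` if these cover the vertices, all pairs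
between them are adjacent, and there are no further edges. -/
theorem adj_iff_of_card_edgeFinset_eq {P Q : Finset V} (hPQ : Disjoint P Q)
    (hcard : #P + #Q = Fintype.card V) (he : #G.edgeFinset = #(G.interedges P Q))
    (hf : ∀ u ∈ P, ∀ v ∈ Q, G.Adj u v) (u v : V) : G.Adj u v ↔ ¬(u ∈ P ↔ v ∈ P) := by
  have hQ : Q = Pᶜ := by
    refine eq_of_subset_of_card_le (fun x hx => mem_compl.2 (Finset.disjoint_right.1 hPQ hx)) ?_
    rw [card_compl]
    omega
  have h := (G.card_interedges_le_card_edgeFinset hPQ).2 he u v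
  simp only [hQ, mem_compl] at h hf
  by_cases hu : u ∈ P <;> by_cases hv : v ∈ P <;> simp only [hu, hv] at h ⊢ <;> simp at h ⊢
  · exact h
  · exact hf u hu v hv
  · exact (hf v hv u hu).symm
  · exact h

end LeastEigenvalue

/-! ### Sequences close to the spectrum of `K_{n,n}` -/

/-- Consequences of a small `ℓ¹` distance from `n, 0, …, 0, -n`. Write the extreme terms as `n + x`
and `y - n`, let `h = n - r`, and let `M` be the sum of the other absolute values. As the terms sum
to zero, `|x + y| ≤ M`; together with `|x| + |y| + M ≤ 2 * h` this bounds `x` and `y` by `h`. If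
`0 ≤ y`, the sum of the squares exceeds `2 * n ^ 2` by at most `2 * n * h + 4 * h ^ 2`, where
`2 * n * h` is only slightly larger than `1`. If `y = h`, then `x ≤ 0` and `M ≤ h + x`. -/
theorem least_bounds_of_sum_abs_sub_le {N n : ℕ} (hN : 2 ≤ N) (hn : 2 ≤ n) {r : ℝ} (hr : 0 ≤ r)
    (hr2 : r ^ 2 = (n : ℝ) ^ 2 - 1) {l : Fin N → ℝ} (hl : ∑ i, l i = 0)
    (hσ : ∑ i, |symmSpectrum n i - l i| ≤ 2 * (n - r)) :
    r ≤ -l ⟨N - 1, by omega⟩ ∧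
      (-l ⟨N - 1, by omega⟩ ≤ n → ∑ i, l i ^ 2 < 2 * n ^ 2 + 2) ∧
      (-l ⟨N - 1, by omega⟩ = r → ∑ i, l i ^ 2 < 2 * n ^ 2) := by
  rw [sum_eq_first_add_last_add_mid hN, symmSpectrum_last _ hN, symmSpectrum_first,
    sum_congr rfl fun i hi => by rw [symmSpectrum_mid _ hi, zero_sub, abs_neg]] at hσ
  rw [sum_eq_first_add_last_add_mid hN] at hl
  rw [sum_eq_first_add_last_add_mid hN]
  have hn' : (2 : ℝ) ≤ n := by exact_mod_cast hn
  have hM1 : |∑ i ∈ midIndices N, l i| ≤ ∑ i ∈ midIndices N, |l i| := abs_sum_le_sum_abs _ _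
  have hM2 : ∑ i ∈ midIndices N, l i ^ 2 ≤ (∑ i ∈ midIndices N, |l i|) ^ 2 := by
    simp_rw [← sq_abs (l _)]
    exact sum_sq_le_sq_sum_of_nonneg fun i _ => abs_nonneg _
  have hM0 : 0 ≤ ∑ i ∈ midIndices N, |l i| := sum_nonneg fun i _ => abs_nonneg _
  set M := ∑ i ∈ midIndices N, |l i|
  set T := ∑ i ∈ midIndices N, l i
  set S := ∑ i ∈ midIndices N, l i ^ 2
  generalize l ⟨0, _⟩ = a at *
  generalize l ⟨N - 1, _⟩ = b at *
  obtain ⟨x, rfl⟩ : ∃ x, a = n + x := ⟨_, (add_sub_cancel _ _).symm⟩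
  obtain ⟨y, rfl⟩ : ∃ y, b = y - n := ⟨_, (add_sub_cancel_right _ _).symm⟩
  obtain ⟨h, rfl⟩ : ∃ h, r = n - h := ⟨n - r, by ring⟩
  have e1 : |(n : ℝ) - (n + x)| = |x| := by rw [sub_add_cancel_left, abs_neg]
  have e2 : |-(n : ℝ) - (y - n)| = |y| := by rw [← abs_neg]; congr 1; ring
  rw [e1, e2] at hσ
  have hxy : |x + y| ≤ M := by
    rw [← abs_neg, show -(x + y) = T by linarith]
    exact hM1
  have hh0 : 0 < h := by nlinarith
  have hh1 : h ≤ 1 / 2 := by nlinarith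
  have hh2 : h * (2 * n - h) = 1 := by linarith
  have hh3 : h ≤ 2 / 7 := by nlinarith
  have a1 := abs_le.1 hxy
  have a2 := le_abs_self x
  have a3 := neg_abs_le x
  have a4 := le_abs_self y
  have a5 := neg_abs_le y
  have hsq : x ^ 2 + y ^ 2 + M ^ 2 ≤ (|x| + |y| + M) ^ 2 := by
    have := abs_nonneg x
    have := abs_nonneg y
    rw [← sq_abs x, ← sq_abs y]
    nlinarith [mul_nonneg (abs_nonneg x) (abs_nonneg y), mul_nonneg (abs_nonneg x) hM0,
      mul_nonneg (abs_nonneg y) hM0]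
  have hxh : x ≤ h := by
    rcases abs_cases x with h1 | h1 <;> linarith
  have hyh : y ≤ h := by
    rcases abs_cases x with h1 | h1 <;> rcases abs_cases y with h2 | h2 <;> linarith
  refine ⟨by linarith, fun hy0 => ?_, fun hy0 => ?_⟩
  · have hy1 : 0 ≤ y := by linarith
    have h1 : (|x| + |y| + M) ^ 2 ≤ (2 * h) ^ 2 :=
      pow_le_pow_left₀ (by positivity) (by linarith) 2
    have h2 : n * (x - y) ≤ n * h := mul_le_mul_of_nonneg_left (by linarith) (by positivity)
    have h3 : h ^ 2 ≤ (2 / 7) ^ 2 := pow_le_pow_left₀ hh0.le hh3 2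
    linarith
  · obtain rfl : y = h := by linarith
    have hx0 : x ≤ 0 := by
      by_contra hc
      have := abs_of_pos (not_le.1 hc)
      linarith
    rw [abs_of_nonpos hx0, abs_of_pos hh0] at *
    have h1 : S ≤ (y + x) ^ 2 := hM2.trans (pow_le_pow_left₀ hM0 (by linarith) 2)
    have h2 : (y + x) ^ 2 ≤ y ^ 2 := pow_le_pow_left₀ (by linarith) (by linarith) 2
    have h3 : (-x) ^ 2 ≤ y ^ 2 := pow_le_pow_left₀ (by linarith) (by linarith) 2
    have h4 : y ^ 2 ≤ (2 / 7) ^ 2 := pow_le_pow_left₀ hh0.le hh3 2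
    have h5 : n * x ≤ 0 := mul_nonpos_of_nonneg_of_nonpos (by positivity) hx0
    linarith

/-! ### Graphs with a spectrum close to that of `K_{n,n}` -/

/-- With `p + q = 2 * n - k`, the square `(p - q) ^ 2 = 4 - 4 * n * k + k ^ 2` would be negative
unless `k = 0`. -/
theorem eq_of_mul_eq_sq_sub_one {n p q : ℕ} (hn : 2 ≤ n) (hle : p + q ≤ 2 * n)
    (hpq : p * q + 1 = n ^ 2) : (p = n - 1 ∧ q = n + 1) ∨ (p = n + 1 ∧ q = n - 1) := by
  obtain ⟨k, hk⟩ := Nat.exists_eq_add_of_le hle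
  have hsq : ((p : ℤ) - q) ^ 2 = (2 * n - k) ^ 2 - 4 * (n ^ 2 - 1) := by
    zify at hk hpq
    rw [hk, ← hpq]
    ring
  rcases Nat.eq_zero_or_pos k with rfl | hk0
  · have h1 : ((p : ℤ) - q) ^ 2 = 2 ^ 2 := by rw [hsq]; push_cast; ring
    rcases sq_eq_sq_iff_eq_or_eq_neg.1 h1 with h | h <;> omega
  · exfalso
    have h1 : k ≤ 2 * n := by omega
    zify at hk0 h1 hn
    rcases eq_or_lt_of_le (Int.add_one_le_iff.2 hk0) with h | h
    · rw [← h] at hsq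
      nlinarith
    · nlinarith

/-- The only graphs whose spectrum is within `2 * (n - √(n ^ 2 - 1))` of that of `K_{n,n}` are
`K_{n,n}` and `K_{n-1,n+1}`. -/
theorem iso_of_sum_abs_sub_le {W : Type*} [Fintype W] (H : SimpleGraph W) {n : ℕ} (hn : 2 ≤ n)
    (hW : Fintype.card W = n + n)
    (hσ : ∑ i, |symmSpectrum n i - H.adjEigenvalue i| ≤ 2 * (n - Real.sqrt ((n : ℝ) ^ 2 - 1))) :
    Nonempty (H ≃g completeBipartiteGraph (Fin n) (Fin n)) ∨
      Nonempty (H ≃g completeBipartiteGraph (Fin (n - 1)) (Fin (n + 1))) := by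
  classical
  have hn' : (2 : ℝ) ≤ n := by exact_mod_cast hn
  have hr2 := Real.sq_sqrt (show (0 : ℝ) ≤ (n : ℝ) ^ 2 - 1 by nlinarith)
  have hr : 0 < Real.sqrt ((n : ℝ) ^ 2 - 1) := Real.sqrt_pos.2 (by nlinarith)
  set r := Real.sqrt ((n : ℝ) ^ 2 - 1)
  obtain ⟨h1, h2, h3⟩ := least_bounds_of_sum_abs_sub_le (by omega) hn hr.le hr2
    H.sum_adjEigenvalue hσ
  rw [sum_adjEigenvalue_sq] at h2 h3
  obtain ⟨z, hz, hz1⟩ := H.exists_unit_eigenvector ⟨Fintype.card W - 1, by omega⟩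
  set b := -H.adjEigenvalue ⟨Fintype.card W - 1, by omega⟩ with hb
  obtain ⟨P, Q, hPQ, hbe, hcomplete⟩ :=
    H.exists_sq_le_card_interedges (hr.trans_le h1) (by rw [hb, neg_neg]; exact hz) hz1
  have hle := (H.card_interedges_le_card_edgeFinset hPQ).1
  have hmul := H.card_interedges_le_mul P Q
  have hcard : #P + #Q ≤ 2 * n := by
    rw [← card_union_of_disjoint hPQ, two_mul, ← hW]
    exact card_le_univ _
  have hmul' : #P * #Q ≤ n ^ 2 := by nlinarith [four_mul_le_sq_add #P #Q]
  have hb2 : r ^ 2 ≤ b ^ 2 := pow_le_pow_left₀ hr.le h1 2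
  have hlow : n ^ 2 ≤ #(H.interedges P Q) + 1 := by
    have : ((n ^ 2 : ℕ) : ℝ) ≤ ((#(H.interedges P Q) + 1 : ℕ) : ℝ) := by push_cast; linarith
    exact_mod_cast this
  have hfull : #(H.interedges P Q) = #P * #Q → ∀ u ∈ P, ∀ v ∈ Q, H.Adj u v := by
    intro heq u hu v hv
    have h4 : H.interedges P Q = P ×ˢ Q :=
      eq_of_subset_of_card_le (filter_subset _ _) (by rw [card_product, heq])
    have h5 : (u, v) ∈ H.interedges P Q := by rw [h4]; simp [hu, hv]
    exact ((mem_interedges_iff H).1 h5).2.2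
  have hiff : #P + #Q = 2 * n → #H.edgeFinset = #(H.interedges P Q) →
      (∀ u ∈ P, ∀ v ∈ Q, H.Adj u v) → ∀ u v, H.Adj u v ↔ ¬(u ∈ P ↔ v ∈ P) :=
    fun hc he hf => H.adj_iff_of_card_edgeFinset_eq hPQ (by omega) he hf
  -- The number of edges between `P` and `Q` is `n ^ 2` or `n ^ 2 - 1`.
  rcases (hmul.trans hmul').eq_or_lt with he | he
  · left
    have hbn : b ≤ n := by
      refine le_of_sq_le_sq ?_ (by positivity)
      rw [he] at hbe
      exact_mod_cast hbe
    have hE : #H.edgeFinset < n ^ 2 + 1 := by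
      have := h2 hbn
      have : ((#H.edgeFinset : ℕ) : ℝ) < ((n ^ 2 + 1 : ℕ) : ℝ) := by push_cast; linarith
      exact_mod_cast this
    have hpq : #P = n ∧ #Q = n := by
      have h4 : #P * #Q = n ^ 2 := by omega
      constructor <;> zify at * <;> nlinarith [sq_nonneg ((#P : ℤ) - #Q)]
    exact nonempty_iso_completeBipartite P hpq.1 hW
      (hiff (by omega) (by omega) (hfull (by rw [he, hpq.1, hpq.2, sq])))
  · right
    have he' : #(H.interedges P Q) + 1 = n ^ 2 := by omega
    have her : (#(H.interedges P Q) : ℝ) = r ^ 2 := by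
      rw [hr2, eq_sub_iff_add_eq]
      exact_mod_cast he'
    -- All estimates are equalities now, so `P` and `Q` are completely joined.
    have hbr : b ^ 2 = r ^ 2 := le_antisymm (her ▸ hbe) hb2
    have hE : #H.edgeFinset < n ^ 2 := by
      have := h3 (by rwa [sq_eq_sq₀ (hr.le.trans h1) hr.le] at hbr)
      have : ((#H.edgeFinset : ℕ) : ℝ) < ((n ^ 2 : ℕ) : ℝ) := by push_cast; linarith
      exact_mod_cast this
    have hf := hcomplete (hbr.trans her.symm)
    have hepq : #(H.interedges P Q) = #P * #Q := by
      rw [← card_product]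
      congr 1
      ext ⟨u, v⟩
      simp only [mem_interedges_iff, mem_product]
      exact ⟨fun h => ⟨h.1, h.2.1⟩, fun h => ⟨h.1, h.2, hf u h.1 v h.2⟩⟩
    rcases eq_of_mul_eq_sq_sub_one hn hcard (hepq ▸ he') with ⟨hp, hq⟩ | ⟨hp, hq⟩
    · exact nonempty_iso_completeBipartite P hp (by omega) (hiff (by omega) (by omega) hf)
    · refine nonempty_iso_completeBipartite Pᶜ (by rw [card_compl]; omega) (by omega) fun u v => ?_
      rw [hiff (by omega) (by omega) hf, mem_compl, mem_compl, not_iff_not (a := u ∈ P)]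

section Distance

variable {W : Type*} [Fintype W] {H : SimpleGraph W} {n : ℕ}

/-- The terms are reindexed by the vertex count of `H`, which avoids casts between index types. -/
theorem spectralDist_completeBipartite (hn : 0 < n)
    (hW : Fintype.card (Fin n ⊕ Fin n) = Fintype.card W) :
    (completeBipartiteGraph (Fin n) (Fin n)).spectralDist H hW =
      ∑ i, |symmSpectrum n i - H.adjEigenvalue i| := by
  rw [spectralDist]
  refine Fintype.sum_equiv (finCongr hW) _ _ fun i => ?_
  rw [adjEigenvalue_completeBipartite Iso.refl hn hn, Real.sqrt_mul_self (Nat.cast_nonneg n)]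
  simp [symmSpectrum, hW]

theorem spectralDist_eq_of_iso (hn : 2 ≤ n)
    (hW : Fintype.card (Fin n ⊕ Fin n) = Fintype.card W) {p q : ℕ} (hp : 0 < p) (hq : 0 < q)
    (f : H ≃g completeBipartiteGraph (Fin p) (Fin q)) :
    (completeBipartiteGraph (Fin n) (Fin n)).spectralDist H hW =
      2 * |(n : ℝ) - Real.sqrt (p * q)| := by
  rw [spectralDist_completeBipartite (by omega), ← sum_abs_symmSpectrum_sub
    (show 2 ≤ Fintype.card W by rw [← hW]; simp; omega)]
  simp only [adjEigenvalue_completeBipartite f hp hq]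

theorem spectralDist_eq_of_iso_pred_succ (hn : 2 ≤ n)
    (hW : Fintype.card (Fin n ⊕ Fin n) = Fintype.card W)
    (f : H ≃g completeBipartiteGraph (Fin (n - 1)) (Fin (n + 1))) :
    (completeBipartiteGraph (Fin n) (Fin n)).spectralDist H hW =
      2 * ((n : ℝ) - Real.sqrt ((n : ℝ) ^ 2 - 1)) := by
  have h : (((n - 1 : ℕ) : ℝ) * ((n + 1 : ℕ) : ℝ)) = (n : ℝ) ^ 2 - 1 := by
    rw [Nat.cast_sub (by omega)]
    push_cast
    ring
  rw [spectralDist_eq_of_iso hn hW (by omega) (by omega) f, h, abs_of_nonneg]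
  exact sub_nonneg.2 (Real.sqrt_le_iff.2 ⟨Nat.cast_nonneg n, by linarith⟩)

theorem iso_of_spectralDist_le (H : SimpleGraph W) (hn : 2 ≤ n)
    (hW : Fintype.card (Fin n ⊕ Fin n) = Fintype.card W)
    (hσ : (completeBipartiteGraph (Fin n) (Fin n)).spectralDist H hW ≤
      2 * ((n : ℝ) - Real.sqrt ((n : ℝ) ^ 2 - 1))) :
    Nonempty (H ≃g completeBipartiteGraph (Fin n) (Fin n)) ∨
      Nonempty (H ≃g completeBipartiteGraph (Fin (n - 1)) (Fin (n + 1))) := by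
  rw [spectralDist_completeBipartite (by omega)] at hσ
  exact iso_of_sum_abs_sub_le H hn (by simpa using hW.symm) hσ

theorem sqrt_sq_sub_one_lt (hn : 2 ≤ n) : Real.sqrt ((n : ℝ) ^ 2 - 1) < n :=
  (Real.sqrt_lt' (by positivity)).2 (by linarith)

end Distance

theorem cospectrality_completeBipartite {n : ℕ} (hn : 2 ≤ n) :
    (completeBipartiteGraph (Fin n) (Fin n)).cospectrality =
      2 * ((n : ℝ) - Real.sqrt ((n : ℝ) ^ 2 - 1)) := by
  have : Nonempty (Fin n) := ⟨⟨0, by omega⟩⟩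
  have : Nontrivial (Fin n ⊕ Fin n) :=
    ⟨Sum.inl ⟨0, by omega⟩, Sum.inr ⟨0, by omega⟩, Sum.inl_ne_inr⟩
  refine (isLeast_cospectrality _).unique ⟨?_, ?_⟩
  · have e : Fin n ⊕ Fin n ≃ Fin (n - 1) ⊕ Fin (n + 1) :=
      Fintype.equivOfCardEq (by simp; omega)
    have f := Iso.comap e (completeBipartiteGraph (Fin (n - 1)) (Fin (n + 1)))
    have h := spectralDist_eq_of_iso_pred_succ hn rfl f
    refine ⟨_, fun ⟨g⟩ => ?_, h.symm⟩
    rw [spectralDist_eq_of_iso hn rfl (by omega) (by omega) g.symm,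
      Real.sqrt_mul_self (Nat.cast_nonneg n), sub_self, abs_zero, mul_zero] at h
    linarith [sqrt_sq_sub_one_lt hn]
  · rintro d ⟨H, hH, rfl⟩
    by_contra! hlt
    rcases iso_of_spectralDist_le H hn rfl hlt.le with ⟨⟨f⟩⟩ | ⟨⟨f⟩⟩
    · exact hH ⟨f.symm⟩
    · exact hlt.ne (spectralDist_eq_of_iso_pred_succ hn rfl f)

end SimpleGraph

theorem theorem1p4 (n : ℕ) (hn : 2 ≤ n) :
    (completeBipartiteGraph (Fin n) (Fin n)).cospectrality =
        2 * ((n : ℝ) - Real.sqrt ((n : ℝ) ^ 2 - 1)) ∧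
      ∀ (W : Type*) [Fintype W] (H : SimpleGraph W)
        (hW : Fintype.card (Fin n ⊕ Fin n) = Fintype.card W),
        (completeBipartiteGraph (Fin n) (Fin n)).cospectrality =
            (completeBipartiteGraph (Fin n) (Fin n)).spectralDist H hW ↔
          Nonempty (H ≃g completeBipartiteGraph (Fin (n - 1)) (Fin (n + 1))) := by
  refine ⟨SimpleGraph.cospectrality_completeBipartite hn, fun W _ H hW => ?_⟩
  rw [SimpleGraph.cospectrality_completeBipartite hn]
  refine ⟨fun h => ?_, fun ⟨f⟩ => (SimpleGraph.spectralDist_eq_of_iso_pred_succ hn hW f).symm⟩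
  refine (SimpleGraph.iso_of_spectralDist_le H hn hW h.ge).resolve_left fun ⟨f⟩ => ?_
  rw [SimpleGraph.spectralDist_eq_of_iso hn hW (by omega) (by omega) f,
    Real.sqrt_mul_self (Nat.cast_nonneg n), sub_self, abs_zero, mul_zero] at h
  linarith [SimpleGraph.sqrt_sq_sub_one_lt hn]
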